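/- All graphs are finite, simple and undirected. A graph $G$ with $n$ vertices is \emph{$k$-connected} if $n>k$ and there is no set of exactly $k-1$ vertices whose deletion leaves a disconnected graph; it is \emph{minimally $k$-connected} if it is $k$-connected and $G-e$ is not $k$-connected for every edge $e$ of $G$. Let $k\ge 2$ and let $G$ be a minimally $k$-connected graph with $n$ vertices and $m$ edges. Let $V_k$ be the set of vertices of degree $k$ in $G$, let $E_k$ be the set of edges of $G$ with both end vertices in $V_k$, and let $c_F$ be the number of connected components of $F=G-V_k$ (where $c_F=0$ if $F$ has no vertices). Then $$|V_k| = \frac{m-n+c_F+|E_k|}{k-1},$$ and, in particular, $$|V_k| \ge \left\lceil \frac{m-n+k}{k-1}\right\rceil .$$ -/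

import Mathlib

namespace MinConn

/-- `S` is a separator of `G`: deleting the vertices in `S` leaves a disconnected graph. -/
def IsSeparator {V : Type*} (G : SimpleGraph V) (S : Finset V) : Prop :=
  ¬ (G.induce ((S : Set V)ᶜ)).Preconnected

/-- `G` is `k`-connected: it has more than `k` vertices and there is no separator consisting of
exactly `k - 1` vertices (for `k = 0` the second condition is void). -/
def IsKConnected {V : Type*} [Fintype V] (G : SimpleGraph V) (k : ℕ) : Prop :=
  k < Fintype.card V ∧ ∀ S : Finset V, S.card + 1 = k → ¬ IsSeparator G S

/-- `G` is minimally `k`-connected: it is `k`-connected, and deleting any edge destroys this. -/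
def IsMinKConnected {V : Type*} [Fintype V] (G : SimpleGraph V) (k : ℕ) : Prop :=
  IsKConnected G k ∧ ∀ e ∈ G.edgeSet, ¬ IsKConnected (G.deleteEdges {e}) k

/-- The set `V_k` of the vertices of degree `k`. -/
def degSet {V : Type*} (G : SimpleGraph V) [G.LocallyFinite] (k : ℕ) : Set V :=
  {v | G.degree v = k}

/-- The set `E_k` of the edges of `G` with both ends in `V_k`. -/
def degEdges {V : Type*} (G : SimpleGraph V) [G.LocallyFinite] (k : ℕ) : Set (Sym2 V) :=
  {e | e ∈ G.edgeSet ∧ ∀ v ∈ e, v ∈ degSet G k}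

/-- The graph `F = G - V_k`. -/
def highGraph {V : Type*} (G : SimpleGraph V) [G.LocallyFinite] (k : ℕ) :
    SimpleGraph ((degSet G k)ᶜ : Set V) :=
  G.induce (degSet G k)ᶜ

/-- The number `c_F` of connected components of `F = G - V_k` (zero if `F` has no vertices). -/
noncomputable def numComp {V : Type*} (G : SimpleGraph V) [G.LocallyFinite] (k : ℕ) : ℕ :=
  Nat.card (highGraph G k).ConnectedComponent

end MinConn

/-! Write m for the number of edges and n for the number of vertices. Counting the ends of edges in
V_k gives m + |E_k| = k|V_k| + e(F). If F is a forest, then e(F) + c_F = n - |V_k|, and the formula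
follows. The bound then amounts to k ≤ |E_k| + c_F.

Both facts rest on the witnesses `Tight` that minimality gives for every edge, uncrossed by
submodularity (`card_cross_corner`). Along a path in F the far sides of the witnesses shrink
strictly (`Tight.disjoint_and_card_lt`), so F has no cycle.

For the bound, suppose a vertex w of degree k avoids some separator for every edge of F. Its
neighbours in F then lie in distinct components, and its other neighbours give edges of E_k. Such a
w is sought in a smallest side A (`IsEnd`). Uncrossing provides it unless A is disjoint from both
sides of some witness; then 2|A| ≤ k + 1, and E_k is large enough by direct counting. -/

namespace MinConn

open Finset

/-! ### Submodularity of edges between sets -/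

section Cross

variable {V : Type*}

/-- The adjacent pairs with first vertex in `A` and second vertex in `B`. -/
def cross (G : SimpleGraph V) [DecidableRel G.Adj] (A B : Finset V) : Finset (V × V) :=
  {e ∈ A ×ˢ B | G.Adj e.1 e.2}

variable {G : SimpleGraph V} [DecidableRel G.Adj] {A B C D : Finset V}

theorem mem_cross {a b : V} : (a, b) ∈ cross G A B ↔ a ∈ A ∧ b ∈ B ∧ G.Adj a b := by
  simp [cross, and_assoc]

theorem card_cross_swap (A B : Finset V) : #(cross G B A) = #(cross G A B) := by
  refine Finset.card_bij (fun e _ => e.swap) ?_ ?_ ?_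
  · rintro ⟨a, b⟩ h
    rw [mem_cross] at h
    exact mem_cross.2 ⟨h.2.1, h.1, h.2.2.symm⟩
  · intro a _ b _ h
    exact Prod.swap_injective h
  · rintro ⟨a, b⟩ h
    rw [mem_cross] at h
    exact ⟨(b, a), mem_cross.2 ⟨h.2.1, h.1, h.2.2.symm⟩, rfl⟩

variable [DecidableEq V]

theorem cross_corner_subset :
    cross G (A ∩ C) (B ∪ D) ∪ cross G (A ∪ C) (B ∩ D) ⊆ cross G A B ∪ cross G C D := by
  rintro ⟨a, b⟩ h
  simp only [mem_union, mem_cross, mem_inter] at h ⊢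
  tauto

theorem card_cross_corner :
    #(cross G (A ∩ C) (B ∪ D)) + #(cross G (A ∪ C) (B ∩ D)) ≤
      #(cross G A B) + #(cross G C D) := by
  rw [← card_union_add_card_inter, ← card_union_add_card_inter (cross G A B)]
  refine add_le_add (card_le_card cross_corner_subset) (card_le_card ?_)
  rintro ⟨a, b⟩ h
  simp only [mem_cross, mem_inter, mem_union] at h ⊢
  tauto

theorem disjoint_inter_union (h1 : Disjoint A B) (h2 : Disjoint C D) :
    Disjoint (A ∩ C) (B ∪ D) :=
  disjoint_union_right.2 ⟨disjoint_of_subset_left inter_subset_left h1,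
    disjoint_of_subset_left inter_subset_right h2⟩

end Cross

/-! ### Mixed vertex and edge cuts -/

section Connected

variable {V : Type*} [Fintype V] [DecidableEq V] {G : SimpleGraph V} [DecidableRel G.Adj] {k : ℕ}
  {A B : Finset V}

theorem IsKConnected.card_add_card_le_of_cross_eq_empty (hG : IsKConnected G k)
    (hA : A.Nonempty) (hB : B.Nonempty) (hAB : Disjoint A B) (h : cross G A B = ∅) :
    #A + #B + k ≤ Fintype.card V := by
  by_contra! hlt
  obtain ⟨hn, hsep⟩ := hG
  obtain ⟨a, ha⟩ := hA
  obtain ⟨b, hb⟩ := hB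
  have hab : a ≠ b := fun h => (Finset.disjoint_left.1 hAB ha) (h ▸ hb)
  rcases Nat.eq_zero_or_pos k with rfl | hk
  · have := card_le_univ (A ∪ B)
    rw [card_union_of_disjoint hAB] at this
    omega
  -- Separators must have exactly `k - 1` vertices, so `A ∪ B` is trimmed to that codimension,
  -- keeping one vertex of each side.
  obtain ⟨U, hU1, hU2, hU3⟩ := Finset.exists_subsuperset_card_eq
    (s := {a, b}) (t := A ∪ B) (n := Fintype.card V - k + 1)
    (by intro x hx; simp only [mem_insert, mem_singleton] at hx; rcases hx with rfl | rfl <;> simp [ha, hb])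
    (by rw [card_pair hab]; omega)
    (by rw [card_union_of_disjoint hAB]; omega)
  have haU : a ∈ U := hU1 (by simp)
  have hbU : b ∈ U := hU1 (by simp)
  refine hsep Uᶜ (by rw [card_compl]; omega) ?_
  intro hpre
  have hclosed : ∀ x y : (((Uᶜ : Finset V) : Set V)ᶜ : Set V),
      (G.induce (((Uᶜ : Finset V) : Set V)ᶜ)).Walk x y → x.1 ∈ A → y.1 ∈ A := by
    intro x y p
    induction p with
    | nil => exact id
    | @cons x y z hxy p ih =>
      intro hx
      refine ih ?_
      have hy : y.1 ∈ A ∪ B := hU2 (by simpa using y.2)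
      rcases mem_union.1 hy with hy | hy
      · exact hy
      · have : (x.1, y.1) ∈ cross G A B := mem_cross.2 ⟨hx, hy, hxy⟩
        simp [h] at this
  obtain ⟨p⟩ := hpre ⟨a, by simpa using haU⟩ ⟨b, by simpa using hbU⟩
  exact Finset.disjoint_left.1 hAB (hclosed _ _ p ha) hb

/-- A crossing edge is destroyed by deleting an end whose side has another vertex. If both sides are
singletons, `k < n` suffices. -/
theorem IsKConnected.card_add_card_le_of_card_cross_le (hG : IsKConnected G k) (d : ℕ)
    (hA : A.Nonempty) (hB : B.Nonempty) (hAB : Disjoint A B) (hd : #(cross G A B) ≤ d) :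
    #A + #B + k ≤ Fintype.card V + d := by
  induction d generalizing A B with
  | zero =>
    exact hG.card_add_card_le_of_cross_eq_empty hA hB hAB (card_eq_zero.1 (Nat.le_zero.1 hd))
  | succ d ih =>
    rcases (cross G A B).eq_empty_or_nonempty with h0 | ⟨⟨x, y⟩, hxy⟩
    · have := hG.card_add_card_le_of_cross_eq_empty hA hB hAB h0
      omega
    obtain ⟨hx, hy, -⟩ := mem_cross.1 hxy
    have key : ∀ A' B' : Finset V, A' ⊆ A → B' ⊆ B → (x, y) ∉ cross G A' B' → A'.Nonempty →
        B'.Nonempty → #A' + #B' + k ≤ Fintype.card V + d := by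
      intro A' B' hA' hB' hn hA'' hB''
      refine ih hA'' hB'' (disjoint_of_subset_left hA' (disjoint_of_subset_right hB' hAB)) ?_
      have hss : cross G A' B' ⊂ cross G A B := by
        refine (Finset.ssubset_iff_of_subset ?_).2 ⟨(x, y), hxy, hn⟩
        rintro ⟨a, b⟩ h
        rw [mem_cross] at h ⊢
        exact ⟨hA' h.1, hB' h.2.1, h.2.2⟩
      have := card_lt_card hss
      omega
    by_cases hA1 : (A.erase x).Nonempty
    · have := key (A.erase x) B (erase_subset _ _) subset_rfl (by simp [mem_cross]) hA1 hB
      rw [card_erase_of_mem hx] at this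
      have := card_pos.2 hA
      omega
    by_cases hB1 : (B.erase y).Nonempty
    · have := key A (B.erase y) subset_rfl (erase_subset _ _) (by simp [mem_cross]) hA hB1
      rw [card_erase_of_mem hy] at this
      have := card_pos.2 hB
      omega
    have h1 := card_eq_zero.2 (not_nonempty_iff_eq_empty.1 hA1)
    have h2 := card_eq_zero.2 (not_nonempty_iff_eq_empty.1 hB1)
    rw [card_erase_of_mem hx] at h1
    rw [card_erase_of_mem hy] at h2
    have := hG.1
    omega

/-- In a `k`-connected graph, deleting vertices and edges, fewer than `k` in total, does not
disconnect two nonempty sets of vertices. -/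
theorem IsKConnected.card_add_card_le (hG : IsKConnected G k)
    (hA : A.Nonempty) (hB : B.Nonempty) (hAB : Disjoint A B) :
    #A + #B + k ≤ Fintype.card V + #(cross G A B) :=
  hG.card_add_card_le_of_card_cross_le _ hA hB hAB le_rfl

theorem IsKConnected.le_degree (hG : IsKConnected G k) (v : V) : k ≤ G.degree v := by
  by_contra! hlt
  have hc : #(insert v (G.neighborFinset v)) = G.degree v + 1 := by
    rw [card_insert_of_notMem (by simp), G.card_neighborFinset_eq_degree]
  have hn := hG.1
  have hB : (insert v (G.neighborFinset v))ᶜ.Nonempty := by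
    rw [← card_pos, card_compl]
    omega
  have := hG.card_add_card_le_of_cross_eq_empty (A := {v}) (singleton_nonempty v) hB
    (by simp) (by
      rw [eq_empty_iff_forall_notMem]
      rintro ⟨a, b⟩ h
      rw [mem_cross] at h
      simp only [mem_singleton, mem_compl, mem_insert, SimpleGraph.mem_neighborFinset] at h
      obtain ⟨rfl, h1, h2⟩ := h
      exact h1 (Or.inr h2))
  rw [card_compl, card_singleton, hc] at this
  omega

end Connected

/-! ### Witnesses for critical edges -/

section Tight

variable {V : Type*} [Fintype V]

/-- The sets `A` and `B` witness that deleting the edge `xy` destroys `k`-connectedness: all but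
`k - 1` vertices lie in `A` or `B`, and `xy` is the only edge between `A ∋ x` and `B ∋ y`. -/
structure Tight (G : SimpleGraph V) [DecidableRel G.Adj] (k : ℕ) (x y : V) (A B : Finset V) :
    Prop where
  disj : Disjoint A B
  card : #A + #B + k = Fintype.card V + 1
  cross_eq : cross G A B = {(x, y)}

variable {G : SimpleGraph V} [DecidableRel G.Adj] {k : ℕ} {A B C D : Finset V} {x y u v z : V}

theorem Tight.mem_and (h : Tight G k x y A B) : x ∈ A ∧ y ∈ B ∧ G.Adj x y := by
  rw [← mem_cross, h.cross_eq, mem_singleton]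

theorem Tight.left_mem (h : Tight G k x y A B) : x ∈ A := h.mem_and.1

theorem Tight.right_mem (h : Tight G k x y A B) : y ∈ B := h.mem_and.2.1

theorem Tight.adj (h : Tight G k x y A B) : G.Adj x y := h.mem_and.2.2

theorem Tight.eq_of_adj (h : Tight G k x y A B) (hu : u ∈ A) (hv : v ∈ B) (huv : G.Adj u v) :
    u = x ∧ v = y := by
  have : (u, v) ∈ cross G A B := mem_cross.2 ⟨hu, hv, huv⟩
  rw [h.cross_eq, mem_singleton] at this
  exact Prod.ext_iff.1 this

theorem Tight.symm (h : Tight G k x y A B) : Tight G k y x B A where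
  disj := h.disj.symm
  card := by have := h.card; omega
  cross_eq := by
    have h1 : (y, x) ∈ cross G B A := mem_cross.2 ⟨h.right_mem, h.left_mem, h.adj.symm⟩
    obtain ⟨e, he⟩ := card_eq_one.1
      (show #(cross G B A) = 1 by rw [card_cross_swap, h.cross_eq, card_singleton])
    rw [he, mem_singleton] at h1
    rw [he, h1]

variable [DecidableEq V]

theorem IsMinKConnected.exists_tight (hG : IsMinKConnected G k) (hxy : G.Adj x y) :
    ∃ A B, Tight G k x y A B := by
  classical
  obtain ⟨hG, hmin⟩ := hG
  have h := hmin s(x, y) hxy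
  simp only [IsKConnected, not_and, not_forall, not_not] at h
  obtain ⟨S, hS, hsep⟩ := h hG.1
  simp only [IsSeparator, SimpleGraph.Preconnected, not_forall] at hsep
  obtain ⟨a, b, hab⟩ := hsep
  set H := (G.deleteEdges {s(x, y)}).induce ((S : Set V)ᶜ) with hH
  let A : Finset V := {v | ∃ hv : v ∈ ((S : Set V)ᶜ), H.Reachable a ⟨v, hv⟩}
  let B : Finset V := Sᶜ \ A
  have haA : a.1 ∈ A := by
    simp only [A, mem_filter, mem_univ, true_and]
    exact ⟨a.2, SimpleGraph.Reachable.refl _⟩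
  have hbB : b.1 ∈ B := by
    simp only [B, A, mem_sdiff, mem_compl, mem_filter, mem_univ, true_and, not_exists]
    exact ⟨fun h => b.2 h, fun _ => hab⟩
  have hAS : A ⊆ Sᶜ := by
    intro v hv
    simp only [A, mem_filter, mem_univ, true_and] at hv
    simpa using hv.1
  have hdis : Disjoint A B := disjoint_sdiff
  have hcard : #A + #B + k = Fintype.card V + 1 := by
    have h1 : #A + #B = #Sᶜ := by
      rw [← card_union_of_disjoint hdis, union_sdiff_of_subset hAS]
    rw [card_compl] at h1
    have := card_le_univ S
    omega
  have hcross : ∀ u ∈ A, ∀ v ∈ B, G.Adj u v → s(u, v) = s(x, y) := by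
    intro u hu v hv huv
    by_contra hne
    simp only [A, mem_filter, mem_univ, true_and] at hu
    obtain ⟨huS, hr⟩ := hu
    obtain ⟨hvS, hvA⟩ := mem_sdiff.1 hv
    apply hvA
    simp only [A, mem_filter, mem_univ, true_and]
    refine ⟨by simpa using hvS, hr.trans (SimpleGraph.Adj.reachable ?_)⟩
    simp only [hH, SimpleGraph.comap_adj, SimpleGraph.deleteEdges_adj]
    exact ⟨huv, by simpa using hne⟩
  have hle := hG.card_add_card_le ⟨_, haA⟩ ⟨_, hbB⟩ hdis
  -- Since `G` itself is `k`-connected, some edge crosses, and by `hcross` it can only be `xy`.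
  obtain ⟨⟨p, q⟩, hpq⟩ : (cross G A B).Nonempty := card_pos.1 (by omega)
  have hpq' := mem_cross.1 hpq
  have hT : Tight G k p q A B := by
    refine ⟨hdis, hcard, eq_singleton_iff_unique_mem.2 ⟨hpq, ?_⟩⟩
    rintro ⟨u, v⟩ huv
    rw [mem_cross] at huv
    have h1 := hcross u huv.1 v huv.2.1 huv.2.2
    rw [← hcross p hpq'.1 q hpq'.2.1 hpq'.2.2, Sym2.eq_iff] at h1
    rcases h1 with ⟨rfl, rfl⟩ | ⟨rfl, rfl⟩
    · rfl
    · exact absurd hpq'.2.1 (Finset.disjoint_left.1 hdis huv.1)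
  have h1 := hcross p hpq'.1 q hpq'.2.1 hpq'.2.2
  rw [Sym2.eq_iff] at h1
  rcases h1 with ⟨rfl, rfl⟩ | ⟨rfl, rfl⟩
  · exact ⟨A, B, hT⟩
  · exact ⟨B, A, hT.symm⟩

/-- If at most two edges join `P` to `Q`, all of them at a vertex `v ∈ Q` of degree more than `k`,
then at least `k - 1` vertices lie outside of `P` and `Q`. -/
theorem IsKConnected.card_add_card_le_of_cross_eq (hG : IsKConnected G k) {P Q : Finset V}
    (hP : P.Nonempty) (hPQ : Disjoint P Q) (hv : v ∈ Q) (hdeg : k < G.degree v)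
    (h : ∀ e ∈ cross G P Q, e.2 = v) (hc : #(cross G P Q) ≤ 2) :
    #P + #Q + k ≤ Fintype.card V + 1 := by
  by_cases hQ : (Q.erase v).Nonempty
  · have := hG.card_add_card_le_of_cross_eq_empty hP hQ
      (disjoint_of_subset_right (erase_subset _ _) hPQ) (by
        rw [eq_empty_iff_forall_notMem]
        rintro ⟨a, b⟩ hab
        rw [mem_cross, mem_erase] at hab
        exact hab.2.1.1 (h (a, b) (mem_cross.2 ⟨hab.1, hab.2.1.2, hab.2.2⟩)))
    rw [card_erase_of_mem hv] at this
    omega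
  -- Here `Q = {v}`: of the more than `k` neighbours of `v`, at most two lie in `P`, so at least `k
  -- - 1` lie outside both.
  · have hQ1 : #Q = 1 := by
      have h1 := card_eq_zero.2 (not_nonempty_iff_eq_empty.1 hQ)
      rw [card_erase_of_mem hv] at h1
      have := card_pos.2 ⟨v, hv⟩
      omega
    have h1 : #(G.neighborFinset v ∩ P) ≤ 2 := by
      refine le_trans ?_ hc
      refine card_le_card_of_injOn (fun a => (a, v)) ?_ ?_
      · intro a ha
        simp only [coe_inter, Set.mem_inter_iff, mem_coe, SimpleGraph.mem_neighborFinset] at ha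
        exact mem_cross.2 ⟨ha.2, hv, ha.1.symm⟩
      · intro a _ b _ hab
        exact (Prod.ext_iff.1 hab).1
    have h2 : #(G.neighborFinset v \ P) ≤ #((insert v P)ᶜ) := by
      refine card_le_card fun a ha => ?_
      simp only [mem_sdiff, SimpleGraph.mem_neighborFinset, mem_compl, mem_insert] at ha ⊢
      rintro (rfl | h)
      · exact G.irrefl ha.1
      · exact ha.2 h
    have h3 := card_sdiff_add_card_inter (G.neighborFinset v) P
    rw [G.card_neighborFinset_eq_degree] at h3
    have hvP : v ∉ P := fun h => Finset.disjoint_left.1 hPQ h hv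
    have h4 := card_le_univ (insert v P)
    rw [card_compl, card_insert_of_notMem hvP] at h2
    rw [card_insert_of_notMem hvP] at h4
    omega

/-- No edge leaves `A ∩ D` for `B ∪ C`, and every edge between `A ∪ D` and `B ∩ C` ends at `v`,
whose large degree saves one in the second corner bound. If `A ∩ D` were nonempty, the two bounds
would add up to less than submodularity allows. -/
theorem Tight.disjoint_and_card_lt (hG : IsKConnected G k) (hdeg : k < G.degree v) (huz : u ≠ z)
    (h1 : Tight G k u v A B) (h2 : Tight G k v z C D) : Disjoint A D ∧ #D < #B := by
  have hvB := h1.right_mem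
  have hvC := h2.left_mem
  have huD : u ∉ D := fun h => huz (h2.eq_of_adj hvC h h1.adj.symm).2
  have hzA : z ∉ A := fun h => huz (h1.eq_of_adj h hvB h2.adj.symm).1.symm
  have hdis1 : Disjoint (A ∩ D) (B ∪ C) :=
    disjoint_inter_union h1.disj h2.disj.symm
  have hdis2 : Disjoint (A ∪ D) (B ∩ C) :=
    (disjoint_inter_union h1.disj.symm h2.disj).symm
  have hcor := card_cross_corner (G := G) (A := A) (B := B) (C := D) (D := C)
  rw [h1.cross_eq, h2.symm.cross_eq, card_singleton, card_singleton] at hcor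
  have hsub := cross_corner_subset (G := G) (A := A) (B := B) (C := D) (D := C)
  rw [h1.cross_eq, h2.symm.cross_eq] at hsub
  have hα := hG.card_add_card_le_of_cross_eq (P := A ∪ D) (Q := B ∩ C)
    ⟨u, mem_union_left _ h1.left_mem⟩ hdis2 (mem_inter.2 ⟨hvB, hvC⟩) hdeg
    (by
      intro e he
      have := hsub (mem_union_right _ he)
      simp only [mem_union, mem_singleton] at this
      rcases this with rfl | rfl <;> rfl) (by omega)
  have e0 : cross G (A ∩ D) (B ∪ C) = ∅ := by
    rw [eq_empty_iff_forall_notMem]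
    rintro ⟨a, b⟩ hab
    have := hsub (mem_union_left _ hab)
    have h3 := mem_inter.1 (mem_cross.1 hab).1
    simp only [mem_union, mem_singleton, Prod.mk.injEq] at this
    rcases this with ⟨rfl, rfl⟩ | ⟨rfl, rfl⟩
    · exact huD h3.2
    · exact hzA h3.1
  have c1 := card_union_add_card_inter A D
  have c2 := card_union_add_card_inter B C
  have c3 := h1.card
  have c4 := h2.card
  have hAD : A ∩ D = ∅ := by
    by_contra hne
    have := hG.card_add_card_le_of_cross_eq_empty (nonempty_iff_ne_empty.2 hne)
      ⟨v, mem_union_left _ hvB⟩ hdis1 e0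
    omega
  refine ⟨disjoint_iff_inter_eq_empty.2 hAD, ?_⟩
  rw [hAD, card_empty] at c1
  have := card_pos.2 ⟨v, mem_inter.2 ⟨hvB, hvC⟩⟩
  omega

end Tight

/-! ### Smallest sides and uncrossing -/

section End

variable {V : Type*} [Fintype V]

/-- `A` is a smallest side of a witness for the criticality of an edge whose ends both have degree
more than `k`. -/
structure IsEnd (G : SimpleGraph V) [DecidableRel G.Adj] (k : ℕ) (x y : V) (A B : Finset V) :
    Prop where
  tight : Tight G k x y A B
  left_lt : k < G.degree x
  right_lt : k < G.degree y
  card_le : ∀ p q C D, k < G.degree p → k < G.degree q → Tight G k p q C D → #A ≤ #C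

variable [DecidableEq V] {G : SimpleGraph V} [DecidableRel G.Adj] {k : ℕ}
  {A B C D : Finset V} {x y p q z w : V}

theorem IsMinKConnected.exists_isEnd (hG : IsMinKConnected G k) (hxy : G.Adj x y)
    (hx : k < G.degree x) (hy : k < G.degree y) : ∃ x y A B, IsEnd G k x y A B := by
  classical
  let P : ℕ → Prop := fun m => ∃ x y A B, k < G.degree x ∧ k < G.degree y ∧ Tight G k x y A B ∧
    #A = m
  have hP : ∃ m, P m := by
    obtain ⟨A, B, h⟩ := hG.exists_tight hxy
    exact ⟨_, x, y, A, B, hx, hy, h, rfl⟩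
  obtain ⟨x, y, A, B, hx, hy, h, hA⟩ := Nat.find_spec hP
  exact ⟨x, y, A, B, h, hx, hy, fun p q C D hp hq hT =>
    hA ▸ Nat.find_min' hP ⟨p, q, C, D, hp, hq, hT, rfl⟩⟩

/-- Continuing from `yx` to another edge `xz` of F would give a side smaller than `A`. -/
theorem IsEnd.eq_of_adj (hG : IsMinKConnected G k) (h : IsEnd G k x y A B) (hxz : G.Adj x z)
    (hz : k < G.degree z) : z = y := by
  by_contra hne
  obtain ⟨C, D, hT⟩ := hG.exists_tight hxz
  have h1 := (Tight.disjoint_and_card_lt hG.1 h.left_lt (Ne.symm hne) h.tight.symm hT).2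
  have h2 := h.card_le z x D C hz h.left_lt hT.symm
  omega

/-- Uncrossing, by which of `xy` and `pq` joins `A ∩ C` to `B ∪ D`. Minimality of `A` either forces
`A ⊆ C` or gives a contradiction; when neither edge does, the opposite corner supplies the new
witness. -/
theorem IsEnd.exists_tight_subset (hG : IsKConnected G k) (h : IsEnd G k x y A B)
    (hT : Tight G k p q C D) (hp : k < G.degree p) (hq : k < G.degree q) (hpx : p ≠ x)
    (hAC : (A ∩ C).Nonempty) : p ∉ A ∧ ∃ C' D', Tight G k p q C' D' ∧ A ⊆ C' := by
  have hcor := card_cross_corner (G := G) (A := A) (B := B) (C := C) (D := D)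
  rw [h.tight.cross_eq, hT.cross_eq, card_singleton, card_singleton] at hcor
  have hsub := cross_corner_subset (G := G) (A := A) (B := B) (C := C) (D := D)
  rw [h.tight.cross_eq, hT.cross_eq] at hsub
  have hsub1 : cross G (A ∩ C) (B ∪ D) ⊆ {(x, y), (p, q)} := subset_union_left.trans hsub
  have hsub2 : cross G (A ∪ C) (B ∩ D) ⊆ {(x, y), (p, q)} := subset_union_right.trans hsub
  have hdis1 := disjoint_inter_union h.tight.disj hT.disj
  have hdis2 := (disjoint_inter_union h.tight.disj.symm hT.disj.symm).symm
  have c1 := card_union_add_card_inter A C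
  have c2 := card_union_add_card_inter B D
  have c3 := h.tight.card
  have c4 := hT.card
  have c5 := h.card_le q p D C hq hp hT.symm
  have hyBD : y ∈ B ∪ D := mem_union_left _ h.tight.right_mem
  have hqBD : q ∈ B ∪ D := mem_union_right _ hT.right_mem
  have hle1 := hG.card_add_card_le hAC ⟨y, hyBD⟩ hdis1
  have hxyne : (x, y) ≠ (p, q) := fun h => hpx (Prod.ext_iff.1 h).1.symm
  have hxmem : (x, y) ∈ cross G (A ∩ C) (B ∪ D) ↔ x ∈ C := by
    simp [mem_cross, h.tight.left_mem, h.tight.right_mem, h.tight.adj]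
  have hpmem : (p, q) ∈ cross G (A ∩ C) (B ∪ D) ↔ p ∈ A := by
    simp [mem_cross, hT.left_mem, hT.right_mem, hT.adj]
  -- As `p ≠ x`, crossing edges have distinct first ends. With `B ∩ D` empty this would make `D`
  -- smaller than `A`.
  have hfst : #(cross G (A ∩ C) (B ∪ D)) ≤ #(A ∩ C) := by
    refine card_le_card_of_injOn Prod.fst (fun e he => (mem_cross.1 he).1) ?_
    intro e he f hf hef
    have he' := hsub1 he
    have hf' := hsub1 hf
    simp only [mem_insert, mem_singleton] at he' hf'
    rcases he' with rfl | rfl <;> rcases hf' with rfl | rfl <;> simp_all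
  have hBD : (B ∩ D).Nonempty := by
    by_contra hne
    rw [not_nonempty_iff_eq_empty.1 hne, card_empty] at c2
    omega
  have hle2 := hG.card_add_card_le ⟨x, mem_union_left _ h.tight.left_mem⟩ hBD hdis2
  by_cases hxC : x ∈ C <;> by_cases hpA : p ∈ A
  · exfalso
    have hcr : cross G (A ∩ C) (B ∪ D) = {(x, y), (p, q)} :=
      subset_antisymm hsub1 (by simp [insert_subset_iff, hxmem, hpmem, hxC, hpA])
    have hcard := card_pair hxyne
    rw [← hcr] at hcard
    have hpAC : p ∈ A ∩ C := mem_inter.2 ⟨hpA, hT.left_mem⟩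
    -- Both edges cross: moving `p` into the separator removes `pq` and leaves a side smaller than
    -- `A`.
    have h1 : Tight G k x y ((A ∩ C).erase p) (B ∪ D) := by
      refine ⟨disjoint_of_subset_left (erase_subset _ _) hdis1, ?_, ?_⟩
      · have := card_pos.2 hAC
        rw [card_erase_of_mem hpAC]
        omega
      · refine subset_antisymm ?_ ?_
        · rintro ⟨a, b⟩ hab
          rw [mem_cross, mem_erase] at hab
          have : (a, b) ∈ cross G (A ∩ C) (B ∪ D) := mem_cross.2 ⟨hab.1.2, hab.2⟩
          rw [hcr, mem_insert, mem_singleton] at this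
          rcases this with h | h
          · exact mem_singleton.2 h
          · exact absurd (Prod.ext_iff.1 h).1 hab.1.1
        · rw [singleton_subset_iff, mem_cross, mem_erase, mem_inter]
          exact ⟨⟨hpx.symm, h.tight.left_mem, hxC⟩, hyBD, h.tight.adj⟩
    have h2 := h.card_le x y _ _ h.left_lt h.right_lt h1
    rw [card_erase_of_mem hpAC] at h2
    have := card_le_card (inter_subset_left (s₁ := A) (s₂ := C))
    have := card_pos.2 hAC
    omega
  · refine ⟨hpA, C, D, hT, ?_⟩
    have hcr : cross G (A ∩ C) (B ∪ D) = {(x, y)} := by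
      refine subset_antisymm (fun e he => ?_) (by simpa [hxmem] using hxC)
      have := hsub1 he
      simp only [mem_insert, mem_singleton] at this ⊢
      rcases this with rfl | rfl
      · rfl
      · exact absurd (hpmem.1 he) hpA
    have h1 : Tight G k x y (A ∩ C) (B ∪ D) := by
      refine ⟨hdis1, ?_, hcr⟩
      rw [hcr, card_singleton] at hle1 hcor
      omega
    exact inter_eq_left.1 (eq_of_subset_of_card_le inter_subset_left
      (h.card_le x y _ _ h.left_lt h.right_lt h1))
  · exfalso
    have hcr : cross G (A ∩ C) (B ∪ D) = {(p, q)} := by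
      refine subset_antisymm (fun e he => ?_) (by simpa [hpmem] using hpA)
      have := hsub1 he
      simp only [mem_insert, mem_singleton] at this ⊢
      rcases this with rfl | rfl
      · exact absurd (hxmem.1 he) hxC
      · rfl
    have h1 : Tight G k p q (A ∩ C) (B ∪ D) := by
      refine ⟨hdis1, ?_, hcr⟩
      rw [hcr, card_singleton] at hle1 hcor
      omega
    have h2 := eq_of_subset_of_card_le inter_subset_left (h.card_le p q _ _ hp hq h1)
    exact hxC (inter_eq_left.1 h2 h.tight.left_mem)
  · refine ⟨hpA, ?_⟩
    have hcr : cross G (A ∩ C) (B ∪ D) = ∅ := by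
      refine eq_empty_of_forall_notMem fun e he => ?_
      have := hsub1 he
      simp only [mem_insert, mem_singleton] at this
      rcases this with rfl | rfl
      · exact hxC (hxmem.1 he)
      · exact hpA (hpmem.1 he)
    rw [hcr, card_empty] at hle1 hcor
    have hcr2 : cross G (A ∪ C) (B ∩ D) = {(x, y), (p, q)} :=
      eq_of_subset_of_card_le hsub2 (by rw [card_pair hxyne]; omega)
    have hcard := card_pair hxyne
    rw [← hcr2] at hcard
    have hy : y ∈ B ∩ D := by
      have : (x, y) ∈ cross G (A ∪ C) (B ∩ D) := by simp [hcr2]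
      exact (mem_cross.1 this).2.1
    have hq' : q ∈ B ∩ D := by
      have : (p, q) ∈ cross G (A ∪ C) (B ∩ D) := by simp [hcr2]
      exact (mem_cross.1 this).2.1
    by_cases hyq : y = q
    · subst hyq
      have := hG.card_add_card_le_of_cross_eq ⟨x, mem_union_left _ h.tight.left_mem⟩ hdis2 hy
        h.right_lt (by rw [hcr2]; simp) hcard.le
      omega
    -- Moving `y` into the separator removes `xy` and leaves `pq` as the only crossing edge.
    · refine ⟨A ∪ C, (B ∩ D).erase y, ⟨disjoint_of_subset_right (erase_subset _ _) hdis2, ?_, ?_⟩,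
        subset_union_left⟩
      · have := card_pos.2 hBD
        rw [card_erase_of_mem hy]
        omega
      · refine subset_antisymm ?_ ?_
        · rintro ⟨a, b⟩ hab
          rw [mem_cross, mem_erase] at hab
          have : (a, b) ∈ cross G (A ∪ C) (B ∩ D) := mem_cross.2 ⟨hab.1, hab.2.1.2, hab.2.2⟩
          rw [hcr2, mem_insert, mem_singleton] at this
          rcases this with h | h
          · exact absurd (Prod.ext_iff.1 h).2 hab.2.1.1
          · exact mem_singleton.2 h
        · rw [singleton_subset_iff, mem_cross, mem_erase]
          exact ⟨mem_union_right _ hT.left_mem, ⟨Ne.symm hyq, hq'⟩, hT.adj⟩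

theorem IsEnd.notMem_of_adj (hG : IsMinKConnected G k) (h : IsEnd G k x y A B)
    (hpq : G.Adj p q) (hp : k < G.degree p) (hq : k < G.degree q) (hpx : p ≠ x) : p ∉ A := by
  intro hpA
  obtain ⟨C, D, hT⟩ := hG.exists_tight hpq
  exact (h.exists_tight_subset hG.1 hT hp hq hpx ⟨p, mem_inter.2 ⟨hpA, hT.left_mem⟩⟩).1 hpA

theorem IsEnd.card_add_card_add_card_le (hG : IsKConnected G k) (h : IsEnd G k x y A B)
    (hT : Tight G k p q C D) (hp : k < G.degree p) (hq : k < G.degree q) (hAC : A ∩ C = ∅) :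
    #A + #C + #(B ∩ D) + k ≤ Fintype.card V + 2 := by
  have c1 := card_union_add_card_inter A C
  rw [hAC, card_empty] at c1
  by_cases hBD : (B ∩ D).Nonempty
  · have hcor := card_cross_corner (G := G) (A := A) (B := B) (C := C) (D := D)
    rw [h.tight.cross_eq, hT.cross_eq, card_singleton, card_singleton] at hcor
    have hdis2 := (disjoint_inter_union h.tight.disj.symm hT.disj.symm).symm
    have := hG.card_add_card_le ⟨x, mem_union_left _ h.tight.left_mem⟩ hBD hdis2
    omega
  · rw [not_nonempty_iff_eq_empty.1 hBD, card_empty]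
    have := h.card_le q p D C hq hp hT.symm
    have := hT.card
    omega

/-- Add the corner bounds for `(C, D)` and `(D, C)`; as `A` misses `C ∪ D`, inclusion-exclusion
bounds `B ∩ (C ∪ D)` from below. -/
theorem IsEnd.two_mul_card_le (hG : IsKConnected G k) (h : IsEnd G k x y A B)
    (hT : Tight G k p q C D) (hp : k < G.degree p) (hq : k < G.degree q) (hAC : A ∩ C = ∅)
    (hAD : A ∩ D = ∅) : 2 * #A ≤ k + 1 := by
  have h1 := h.card_add_card_add_card_le hG hT hp hq hAC
  have h2 := h.card_add_card_add_card_le hG hT.symm hq hp hAD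
  have c3 := h.tight.card
  have c4 := hT.card
  have c5 : #(B ∩ C) + #(B ∩ D) = #(B ∩ (C ∪ D)) := by
    rw [inter_union_distrib_left, card_union_of_disjoint]
    exact disjoint_of_subset_left inter_subset_right
      (disjoint_of_subset_right inter_subset_right hT.disj)
  have c6 := card_union_add_card_inter B (C ∪ D)
  rw [card_union_of_disjoint hT.disj] at c6
  have c7 : #(B ∪ (C ∪ D)) + #A ≤ Fintype.card V := by
    rw [← card_union_of_disjoint]
    · exact card_le_univ _
    · rw [disjoint_union_left, disjoint_union_left]
      exact ⟨h.tight.disj.symm, (disjoint_iff_inter_eq_empty.2 hAC).symm,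
        (disjoint_iff_inter_eq_empty.2 hAD).symm⟩
  omega

end End

/-! ### Forests and trails -/

section Forest

variable {V : Type*} {G : SimpleGraph V}

theorem card_edgeFinset_add_card_connectedComponent [Fintype V] [DecidableRel G.Adj]
    (h : G.IsAcyclic) : #G.edgeFinset + Nat.card G.ConnectedComponent = Fintype.card V := by
  classical
  have h1 : ∀ C : G.ConnectedComponent, ∑ v : {v // G.connectedComponentMk v = C}, G.degree v + 2 =
      2 * Fintype.card {v // G.connectedComponentMk v = C} := by
    intro C
    have hT := (h.isTree_connectedComponent C).card_edgeFinset
    have hD := C.toSimpleGraph.sum_degrees_eq_twice_card_edges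
    have hdeg : ∀ v : C, C.toSimpleGraph.degree v = G.degree v.1 := by
      intro v
      unfold SimpleGraph.ConnectedComponent.toSimpleGraph
      have hsub : G.neighborSet v.1 ⊆ C.supp := by
        intro w hw
        rw [SimpleGraph.mem_neighborSet] at hw
        exact (C.mem_supp_congr_adj hw).1 v.2
      convert SimpleGraph.degree_induce_of_neighborSet_subset (G := G) (s := C.supp) (v := v) hsub
      rfl
    simp only [hdeg] at hD
    have e1 : ∑ v : {v // G.connectedComponentMk v = C}, G.degree v.1 = ∑ v : C, G.degree v.1 := by
      refine Fintype.sum_equiv (Equiv.refl _) _ _ fun _ => rfl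
    have e2 : Fintype.card {v // G.connectedComponentMk v = C} = Fintype.card C :=
      Fintype.card_congr (Equiv.refl _)
    rw [e1, e2, hD, ← hT]
    ring
  have h2 := Finset.sum_congr rfl fun (C : G.ConnectedComponent) (_ : C ∈ univ) => h1 C
  rw [Finset.sum_add_distrib,
    Fintype.sum_fiberwise G.connectedComponentMk (fun v => G.degree v), ← Finset.mul_sum,
    G.sum_degrees_eq_twice_card_edges] at h2
  have h3 : ∑ C : G.ConnectedComponent, Fintype.card {v // G.connectedComponentMk v = C} =
      Fintype.card V := by
    simpa using
      Fintype.sum_fiberwise G.connectedComponentMk (fun _ => (1 : ℕ))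
  rw [h3] at h2
  simp only [sum_const, card_univ, smul_eq_mul] at h2
  rw [Nat.card_eq_fintype_card]
  omega

/-- Carries a property of directed edges along a trail; being a trail serves only to exclude turning
back. -/
theorem isTrail_cons_induction {R : V → V → Prop}
    (step : ∀ u v z, G.Adj u v → G.Adj v z → u ≠ z → R u v → R v z) {v z : V} (p : G.Walk v z)
    {u : V} (h : G.Adj u v) (ht : (SimpleGraph.Walk.cons h p).IsTrail) (hR : R u v) :
    R (SimpleGraph.Walk.cons h p).penultimate z := by
  induction p generalizing u with
  | nil => exact hR
  | @cons v t z h' p ih =>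
    rw [SimpleGraph.Walk.penultimate_cons_cons]
    have ht' := (SimpleGraph.Walk.isTrail_cons h _).1 ht
    refine ih h' ht'.1 (step u v t h h' ?_ hR)
    rintro rfl
    apply ht'.2
    simp [Sym2.eq_swap]

end Forest

/-! ### F is a forest; neighbours of a good vertex -/

section High

variable {V : Type*} [Fintype V] {G : SimpleGraph V} [DecidableRel G.Adj] {k : ℕ}

theorem highGraph_isAcyclic [DecidableEq V] (hG : IsMinKConnected G k) :
    (highGraph G k).IsAcyclic := by
  have hdeg : ∀ v : ((degSet G k)ᶜ : Set V), k < G.degree v.1 := fun v =>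
    lt_of_le_of_ne (hG.1.le_degree v.1) (fun h => v.2 h.symm)
  intro u c hc
  cases c with
  | nil => exact hc.ne_nil rfl
  | @cons _ v _ h p =>
    classical
    have hex : ∃ m, ∃ A B, Tight G k u.1 v.1 A B ∧ #B = m := by
      obtain ⟨A, B, hT⟩ := hG.exists_tight (show G.Adj u.1 v.1 from h)
      exact ⟨_, A, B, hT, rfl⟩
    obtain ⟨m, A, B, hT, rfl⟩ := hex
    obtain ⟨C, D, hT', hle⟩ := isTrail_cons_induction
      (R := fun a b => ∃ C D, Tight G k a.1 b.1 C D ∧ #D ≤ #B) (by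
        rintro a b z hab hbz haz ⟨C, D, hCD, hle⟩
        obtain ⟨C', D', hT'⟩ := hG.exists_tight (show G.Adj b.1 z.1 from hbz)
        have := (Tight.disjoint_and_card_lt hG.1 (hdeg b)
          (fun h => haz (Subtype.ext h)) hCD hT').2
        exact ⟨C', D', hT', by omega⟩) p h hc.isTrail ⟨A, B, hT, le_rfl⟩
    -- Passing from the last edge of the cycle back to the first makes the far side strictly smaller
    -- than itself.
    have hne := hc.snd_ne_penultimate
    simp only [SimpleGraph.Walk.snd_cons] at hne
    have := (Tight.disjoint_and_card_lt hG.1 (hdeg u)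
          (fun h => hne (Subtype.ext h).symm) hT' hT).2
    omega

/-- If a vertex `w` of degree `k` avoids some separator for every edge of `F`, then its neighbours
in `F` lie in distinct components of `F`. -/
theorem eq_of_reachable_highGraph [DecidableEq V] (hG : IsMinKConnected G k) {w : V}
    (hw : G.degree w = k)
    (h : ∀ p q, G.Adj p q → k < G.degree p → k < G.degree q →
      ∃ C D, Tight G k p q C D ∧ (w ∈ C ∨ w ∈ D))
    {a b : ((degSet G k)ᶜ : Set V)} (ha : G.Adj w a) (hb : G.Adj w b)
    (hab : (highGraph G k).Reachable a b) : a = b := by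
  have hdeg : ∀ v : ((degSet G k)ᶜ : Set V), k < G.degree v.1 := fun v =>
    lt_of_le_of_ne (hG.1.le_degree v.1) (fun h => v.2 h.symm)
  have hne : ∀ v : ((degSet G k)ᶜ : Set V), w ≠ v.1 := by
    rintro v rfl
    exact (hdeg v).ne' hw
  obtain ⟨p, hp⟩ := hab.exists_isPath
  cases p with
  | nil => rfl
  | @cons _ v _ hav p =>
    exfalso
    -- `w` starts on the near side because it is adjacent to `a`, and stays there since `A ∩ D = ∅`
    -- at each step. At the last edge it would be a second vertex on that side adjacent to `b`.
    obtain ⟨C, D, hT, hwC⟩ := isTrail_cons_induction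
      (R := fun a b => ∃ C D, Tight G k a.1 b.1 C D ∧ w ∈ C) (by
        rintro u v z huv hvz huz ⟨A, B, hT, hwA⟩
        obtain ⟨C, D, hT', hwCD⟩ := h v.1 z.1 hvz (hdeg v) (hdeg z)
        refine ⟨C, D, hT', hwCD.resolve_right fun hwD => ?_⟩
        exact Finset.disjoint_left.1 (Tight.disjoint_and_card_lt hG.1 (hdeg v)
          (fun h => huz (Subtype.ext h)) hT hT').1 hwA hwD) p hav hp.isTrail (by
        obtain ⟨C, D, hT', hwCD⟩ := h a.1 v.1 hav (hdeg a) (hdeg v)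
        refine ⟨C, D, hT', hwCD.resolve_right fun hwD => ?_⟩
        exact hne v (hT'.eq_of_adj hT'.left_mem hwD ha.symm).2)
    exact hne _ (hT.eq_of_adj hwC hT.right_mem hb).1

/-- The neighbours of `w` of degree `k`. -/
def lowNeighbors (G : SimpleGraph V) [DecidableRel G.Adj] (k : ℕ) (w : V) : Finset V :=
  {v ∈ G.neighborFinset w | G.degree v = k}

theorem mem_lowNeighbors {v w : V} : v ∈ lowNeighbors G k w ↔ G.Adj w v ∧ G.degree v = k := by
  simp [lowNeighbors]

theorem mk_mem_degEdges {v w : V} :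
    s(v, w) ∈ degEdges G k ↔ G.Adj v w ∧ G.degree v = k ∧ G.degree w = k := by
  simp [degEdges, degSet]

theorem card_lowNeighbors_le {w : V} (hw : G.degree w = k) :
    #(lowNeighbors G k w) ≤ (degEdges G k).ncard := by
  rw [← Set.ncard_coe_finset]
  refine Set.ncard_le_ncard_of_injOn (fun v => s(w, v)) ?_ ?_ (Set.toFinite _)
  · intro v hv
    rw [mem_coe, mem_lowNeighbors] at hv
    exact mk_mem_degEdges.2 ⟨hv.1, hw, hv.2⟩
  · intro a _ b _ hab
    exact Sym2.congr_right.1 hab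

theorem card_lowNeighbors_add_le [DecidableEq V] {v w : V} (hv : G.degree v = k)
    (hw : G.degree w = k) (hvw : v ≠ w) :
    #(lowNeighbors G k v) + #(lowNeighbors G k w) ≤ (degEdges G k).ncard + 1 := by
  have hinj : ∀ u : V, Function.Injective fun x => s(u, x) := by
    intro u a b hab
    exact Sym2.congr_right.1 hab
  rw [← card_image_of_injective _ (hinj v), ← card_image_of_injective (lowNeighbors G k w) (hinj w),
    ← card_union_add_card_inter]
  refine add_le_add ?_ ?_
  · rw [← Set.ncard_coe_finset]
    refine Set.ncard_le_ncard ?_ (Set.toFinite _)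
    intro e he
    simp only [coe_union, coe_image, Set.mem_union, Set.mem_image, mem_coe, mem_lowNeighbors] at he
    rcases he with ⟨x, hx, rfl⟩ | ⟨x, hx, rfl⟩
    · exact mk_mem_degEdges.2 ⟨hx.1, hv, hx.2⟩
    · exact mk_mem_degEdges.2 ⟨hx.1, hw, hx.2⟩
  -- The only edge that both families can share is `vw`.
  · rw [← card_singleton s(v, w)]
    refine card_le_card fun e he => ?_
    rw [mem_inter, mem_image, mem_image] at he
    obtain ⟨⟨x, -, rfl⟩, y, -, hxy⟩ := he
    rw [Sym2.eq_iff] at hxy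
    rcases hxy with ⟨h, -⟩ | ⟨h, -⟩
    · exact absurd h.symm hvw
    · rw [h]
      simp

/-- The neighbours of `w` of degree other than `k`. -/
def highNeighbors (G : SimpleGraph V) [DecidableRel G.Adj] (k : ℕ) (w : V) : Finset V :=
  {v ∈ G.neighborFinset w | ¬ G.degree v = k}

theorem mem_highNeighbors {v w : V} : v ∈ highNeighbors G k w ↔ G.Adj w v ∧ G.degree v ≠ k := by
  simp [highNeighbors]

theorem card_lowNeighbors_add_card_highNeighbors (w : V) :
    #(lowNeighbors G k w) + #(highNeighbors G k w) = G.degree w := by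
  rw [lowNeighbors, highNeighbors, card_filter_add_card_filter_not,
    G.card_neighborFinset_eq_degree]

theorem le_card_degEdges_add_numComp_of_forall [DecidableEq V] (hG : IsMinKConnected G k) {w : V}
    (hw : G.degree w = k)
    (h : ∀ p q, G.Adj p q → k < G.degree p → k < G.degree q →
      ∃ C D, Tight G k p q C D ∧ (w ∈ C ∨ w ∈ D)) :
    k ≤ (degEdges G k).ncard + numComp G k := by
  have h1 := card_lowNeighbors_add_card_highNeighbors (G := G) (k := k) w
  have h2 := card_lowNeighbors_le (G := G) hw
  have h3 : #(highNeighbors G k w) ≤ numComp G k := by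
    rw [numComp, ← Fintype.card_coe, ← Nat.card_eq_fintype_card]
    refine Nat.card_le_card_of_injective
      (fun v : highNeighbors G k w => (highGraph G k).connectedComponentMk
        ⟨v.1, (mem_highNeighbors.1 v.2).2⟩) ?_
    intro a b hab
    have := eq_of_reachable_highGraph hG hw h (mem_highNeighbors.1 a.2).1
      (mem_highNeighbors.1 b.2).1 (SimpleGraph.ConnectedComponent.exact hab)
    exact Subtype.ext (congrArg (fun v => v.1) this)
  omega

end High

/-! ### The bound k ≤ |E_k| + c_F -/

section Small

variable {V : Type*} [Fintype V] [DecidableEq V] {G : SimpleGraph V} [DecidableRel G.Adj] {k : ℕ}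
  {A B : Finset V} {x y w : V}

theorem IsEnd.erase_neighborFinset (hG : IsMinKConnected G k) (h : IsEnd G k x y A B) :
    (∀ v ∈ (G.neighborFinset x).erase y, v ∉ B ∧ G.degree v = k) ∧
      k ≤ #((G.neighborFinset x).erase y) := by
  constructor
  · intro v hv
    rw [mem_erase, SimpleGraph.mem_neighborFinset] at hv
    refine ⟨fun hvB => hv.1 (h.tight.eq_of_adj h.tight.left_mem hvB hv.2).2, ?_⟩
    by_contra hne
    exact hv.1 (h.eq_of_adj hG hv.2 (lt_of_le_of_ne (hG.1.le_degree v) (Ne.symm hne)))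
  · rw [card_erase_of_mem (by simpa using h.tight.adj), G.card_neighborFinset_eq_degree]
    have := h.left_lt
    omega

/-- Otherwise the at least `k` neighbours of `x` other than `y` would all lie in the separator of `k
- 1` vertices. -/
theorem IsEnd.exists_degree_eq (hG : IsMinKConnected G k) (hk : 1 ≤ k) (h : IsEnd G k x y A B) :
    ∃ w ∈ A, G.degree w = k := by
  obtain ⟨h1, h2⟩ := h.erase_neighborFinset hG
  by_contra! hno
  have h3 : (G.neighborFinset x).erase y ⊆ (A ∪ B)ᶜ := by
    intro v hv
    rw [mem_compl, mem_union, not_or]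
    exact ⟨fun hvA => hno v hvA (h1 v hv).2, (h1 v hv).1⟩
  have h4 := card_le_card h3
  rw [card_compl, card_union_of_disjoint h.tight.disj] at h4
  have := h.tight.card
  have := card_pos.2 ⟨x, h.tight.left_mem⟩
  have := card_pos.2 ⟨y, h.tight.right_mem⟩
  have := hG.1.1
  omega

/-- These neighbours and the at least `k` neighbours of `x` other than `y` are disjoint sets inside
`Bᶜ`, which has `#A + k - 1` elements. -/
theorem IsEnd.card_highNeighbors_lt (hG : IsMinKConnected G k) (hk : 1 ≤ k) (h : IsEnd G k x y A B)
    (hwA : w ∈ A) (hw : G.degree w = k) : #(highNeighbors G k w) < #A := by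
  obtain ⟨h1, h2⟩ := h.erase_neighborFinset hG
  have hsub : highNeighbors G k w ∪ (G.neighborFinset x).erase y ⊆ Bᶜ := by
    intro v hv
    rw [mem_compl]
    rcases mem_union.1 hv with hv | hv
    · intro hvB
      have := (h.tight.eq_of_adj hwA hvB (mem_highNeighbors.1 hv).1).1
      rw [this] at hw
      exact h.left_lt.ne' hw
    · exact (h1 v hv).1
  have h3 := card_le_card hsub
  rw [card_union_of_disjoint, card_compl] at h3
  · have := h.tight.card
    omega
  · rw [Finset.disjoint_left]
    intro v hv hv'
    exact (mem_highNeighbors.1 hv).2 (h1 v hv').2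

/-- Each vertex of degree `k` in `A` has at least `k + 1 - #A` neighbours of degree `k`. Two such
vertices already give `k` edges of E_k; if there is only one, then `#A ≤ 2`, and one component of F
makes up the difference. -/
theorem IsEnd.le_card_degEdges_add_numComp (hG : IsMinKConnected G k) (hk : 1 ≤ k) (h : IsEnd G k x y A B)
    (hA : 2 * #A ≤ k + 1) : k ≤ (degEdges G k).ncard + numComp G k := by
  obtain ⟨w, hwA, hw⟩ := h.exists_degree_eq hG hk
  have hlow : ∀ w ∈ A, G.degree w = k → k + 1 ≤ #(lowNeighbors G k w) + #A := by
    intro w hwA hw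
    have h1 := card_lowNeighbors_add_card_highNeighbors (G := G) (k := k) w
    have h2 := h.card_highNeighbors_lt hG hk hwA hw
    omega
  by_cases hw' : ∃ w' ∈ A, w' ≠ w ∧ G.degree w' = k
  · obtain ⟨w', hwA', hne, hw'⟩ := hw'
    have h1 := hlow w hwA hw
    have h2 := hlow w' hwA' hw'
    have h3 := card_lowNeighbors_add_le hw' hw hne
    omega
  have hhigh : ∀ z ∈ A, z ≠ w → k < G.degree z := fun z hz hzw =>
    lt_of_le_of_ne (hG.1.le_degree z) fun hd => hw' ⟨z, hz, hzw, hd.symm⟩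
  have hA2 : A ⊆ {x, w} := by
    intro z hzA
    by_contra hz
    simp only [mem_insert, mem_singleton, not_or] at hz
    have hzd := hhigh z hzA hz.2
    -- A vertex of `A` other than `x` has no F-neighbour, so this inclusion caps its degree at `1 +
    -- (k - 1)`.
    have hsub : G.neighborFinset z ⊆ insert w (A ∪ B)ᶜ := by
      intro v hv
      rw [SimpleGraph.mem_neighborFinset] at hv
      rw [mem_insert, mem_compl, mem_union]
      by_contra! hcon
      rcases hcon.2 with hvA | hvB
      · exact h.notMem_of_adj hG hv hzd (hhigh v hvA hcon.1) hz.1 hzA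
      · exact hz.1 (h.tight.eq_of_adj hzA hvB hv).1
    have h1 := (card_le_card hsub).trans (card_insert_le _ _)
    rw [G.card_neighborFinset_eq_degree, card_compl, card_union_of_disjoint h.tight.disj] at h1
    have := h.tight.card
    have := hG.1.1
    omega
  have h1 := (card_le_card hA2).trans card_le_two
  have h2 := hlow w hwA hw
  have h3 := card_lowNeighbors_le (G := G) hw
  have h4 : 0 < numComp G k := by
    have : Nonempty (highGraph G k).ConnectedComponent :=
      ⟨(highGraph G k).connectedComponentMk ⟨x, fun hx => h.left_lt.ne' hx⟩⟩
    exact Nat.card_pos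
  omega

theorem le_card_degEdges_add_numComp (hG : IsMinKConnected G k) (hk : 1 ≤ k) :
    k ≤ (degEdges G k).ncard + numComp G k := by
  by_cases hF : ∃ x y, G.Adj x y ∧ k < G.degree x ∧ k < G.degree y
  · obtain ⟨x, y, hxy, hx, hy⟩ := hF
    obtain ⟨x, y, A, B, h⟩ := hG.exists_isEnd hxy hx hy
    by_cases hA : 2 * #A ≤ k + 1
    · exact h.le_card_degEdges_add_numComp hG hk hA
    obtain ⟨w, hwA, hw⟩ := h.exists_degree_eq hG hk
    -- With `A` large, any vertex of degree `k` in `A` is good: edges at `x` are `xy` itself, and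
    -- the others can be uncrossed.
    refine le_card_degEdges_add_numComp_of_forall hG hw fun p q hpq hp hq => ?_
    by_cases hpx : p = x
    · subst hpx
      have := h.eq_of_adj hG hpq hq
      subst this
      exact ⟨A, B, h.tight, Or.inl hwA⟩
    by_cases hqx : q = x
    · subst hqx
      have := h.eq_of_adj hG hpq.symm hp
      subst this
      exact ⟨B, A, h.tight.symm, Or.inr hwA⟩
    obtain ⟨C, D, hT⟩ := hG.exists_tight hpq
    by_cases hAC : (A ∩ C).Nonempty
    · obtain ⟨-, C', D', hT', hsub⟩ := h.exists_tight_subset hG.1 hT hp hq hpx hAC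
      exact ⟨C', D', hT', Or.inl (hsub hwA)⟩
    by_cases hAD : (A ∩ D).Nonempty
    · obtain ⟨-, C', D', hT', hsub⟩ := h.exists_tight_subset hG.1 hT.symm hq hp hqx hAD
      exact ⟨D', C', hT'.symm, Or.inr (hsub hwA)⟩
    exact absurd (h.two_mul_card_le hG.1 hT hp hq (not_nonempty_iff_eq_empty.1 hAC)
      (not_nonempty_iff_eq_empty.1 hAD)) hA
  · have hw : ∃ w, G.degree w = k := by
      by_contra! hno
      have hdeg : ∀ v, k < G.degree v := fun v => lt_of_le_of_ne (hG.1.le_degree v) (hno v).symm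
      obtain ⟨v⟩ : Nonempty V := Fintype.card_pos_iff.1 (by have := hG.1.1; omega)
      obtain ⟨u, hu⟩ := (G.degree_pos_iff_exists_adj v).1 (by have := hdeg v; omega)
      exact hF ⟨v, u, hu, hdeg v, hdeg u⟩
    obtain ⟨w, hw⟩ := hw
    exact le_card_degEdges_add_numComp_of_forall hG hw fun p q hpq hp hq =>
      absurd ⟨p, q, hpq, hp, hq⟩ hF

end Small

/-! ### Double counting edge ends in V_k -/

section Count

variable {V : Type*} [Fintype V] {G : SimpleGraph V} [DecidableRel G.Adj] {k : ℕ}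

theorem ncard_edgeSet_add_ncard_degEdges :
    G.edgeSet.ncard + (degEdges G k).ncard =
      k * (degSet G k).ncard + (highGraph G k).edgeSet.ncard := by
  classical
  have hF : (highGraph G k).edgeSet.ncard = #{e ∈ G.edgeFinset | ∀ v ∈ e, G.degree v ≠ k} := by
    rw [← Set.ncard_image_of_injective _
      (Sym2.map.injective (Subtype.val_injective (p := (· ∈ (degSet G k)ᶜ)))),
      ← Set.ncard_coe_finset]
    congr 1
    ext e
    induction e with
    | h a b =>
      simp only [Set.mem_image, coe_filter, SimpleGraph.mem_edgeFinset, Set.mem_ofPred_eq,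
        SimpleGraph.mem_edgeSet, Sym2.mem_iff, forall_eq_or_imp, forall_eq]
      constructor
      · rintro ⟨e, he, hab⟩
        induction e with
        | h c d =>
          rw [Sym2.map_mk, Sym2.eq_iff] at hab
          have hcd : G.Adj c.1 d.1 := he
          rcases hab with ⟨rfl, rfl⟩ | ⟨rfl, rfl⟩
          · exact ⟨hcd, c.2, d.2⟩
          · exact ⟨hcd.symm, d.2, c.2⟩
      · rintro ⟨hab, ha, hb⟩
        exact ⟨s(⟨a, ha⟩, ⟨b, hb⟩), hab, rfl⟩
  have hE : (degEdges G k).ncard = #{e ∈ G.edgeFinset | ∀ v ∈ e, G.degree v = k} := by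
    rw [← Set.ncard_coe_finset]
    congr 1
    ext e
    simp [degEdges, degSet]
  have hV : (degSet G k).ncard = #{v | G.degree v = k} := by
    rw [← Set.ncard_coe_finset]
    congr 1
    ext v
    simp [degSet]
  have hm : G.edgeSet.ncard = #G.edgeFinset := by
    rw [← Set.ncard_coe_finset, SimpleGraph.coe_edgeFinset]
  have hdouble : k * #{v | G.degree v = k} =
      ∑ e ∈ G.edgeFinset, #{v | G.degree v = k ∧ v ∈ e} := by
    have h1 : ∑ v with G.degree v = k, #{e ∈ G.edgeFinset | v ∈ e} = k * #{v | G.degree v = k} := by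
      rw [mul_comm, ← smul_eq_mul, ← sum_const]
      refine sum_congr rfl fun v hv => ?_
      rw [← (mem_filter.1 hv).2, ← G.card_incidenceFinset_eq_degree, G.incidenceFinset_eq_filter]
    rw [← h1]
    simp only [card_filter _ univ, card_filter _ G.edgeFinset]
    rw [sum_comm]
    refine sum_congr rfl fun e _ => ?_
    rw [sum_filter]
    exact sum_congr rfl fun v _ => (ite_and _ _ _ _).symm
  -- Edge by edge: 1 + [both ends in V_k] = (number of ends in V_k) + [no end in V_k].
  rw [hF, hE, hV, hm, hdouble, card_filter, card_filter, card_eq_sum_ones, ← sum_add_distrib,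
    ← sum_add_distrib]
  refine sum_congr rfl fun e he => ?_
  induction e with
  | h a b =>
    have hab : a ≠ b := (SimpleGraph.mem_edgeFinset.1 he : G.Adj a b).ne
    have : ({v | G.degree v = k ∧ v ∈ s(a, b)} : Finset V) =
        {v ∈ ({a, b} : Finset V) | G.degree v = k} := by
      ext v
      simp [and_comm]
    rw [this, card_filter, sum_pair hab]
    simp only [Sym2.mem_iff, forall_eq_or_imp, forall_eq]
    by_cases ha : G.degree a = k <;> by_cases hb : G.degree b = k <;> simp [ha, hb]

end Count

end MinConn

theorem mainTheorem3 {V : Type*} [Fintype V] (G : SimpleGraph V) [DecidableRel G.Adj]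
    (k : ℕ) (hk : 2 ≤ k) (hG : MinConn.IsMinKConnected G k) :
    ((MinConn.degSet G k).ncard : ℚ) =
        ((G.edgeSet.ncard : ℚ) - (Fintype.card V : ℚ) + (MinConn.numComp G k : ℚ)
          + ((MinConn.degEdges G k).ncard : ℚ)) / ((k : ℚ) - 1) ∧
      ⌈((G.edgeSet.ncard : ℚ) - (Fintype.card V : ℚ) + (k : ℚ)) / ((k : ℚ) - 1)⌉ ≤
        ((MinConn.degSet G k).ncard : ℤ) := by
  classical
  have h1 := MinConn.ncard_edgeSet_add_ncard_degEdges (G := G) (k := k)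
  have h2 := MinConn.card_edgeFinset_add_card_connectedComponent (MinConn.highGraph_isAcyclic hG)
  rw [← Set.ncard_coe_finset, SimpleGraph.coe_edgeFinset, ← Nat.card_eq_fintype_card,
    Nat.card_coe_set_eq] at h2
  have h3 := Set.ncard_add_ncard_compl (MinConn.degSet G k)
  rw [Nat.card_eq_fintype_card] at h3
  have h4 := MinConn.le_card_degEdges_add_numComp hG (by omega)
  change _ + MinConn.numComp G k = _ at h2
  have hk' : (0 : ℚ) < (k : ℚ) - 1 := by
    have : (2 : ℚ) ≤ k := by exact_mod_cast hk
    linarith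
  qify at h1 h2 h3 h4
  have heq : ((MinConn.degSet G k).ncard : ℚ) =
      ((G.edgeSet.ncard : ℚ) - (Fintype.card V : ℚ) + (MinConn.numComp G k : ℚ)
        + ((MinConn.degEdges G k).ncard : ℚ)) / ((k : ℚ) - 1) := by
    rw [eq_div_iff hk'.ne']
    linarith
  refine ⟨heq, Int.ceil_le.2 ?_⟩
  rw [Int.cast_natCast, heq]
  exact div_le_div_of_nonneg_right (by linarith) hk'.le
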